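/- Let $d,N\ge 1$ and let $H(\mathbf z)=\sum_{\mathbf n\in\mathbb Z^d} z_1^{n_1}\cdots z_d^{n_d}\,T_{\mathbf n}$ be a finite-range $N$-band Hamiltonian, i.e. $T_{\mathbf n}\in\mathbb C^{N\times N}$ and only finitely many $T_{\mathbf n}$ are nonzero. Put $\mathcal M=\{(\mathbf z,E): z_i\neq 0 \text{ for all } i,\ \det(E-H(\mathbf z))=0\}\subset\mathbb C^d\times\mathbb C$, let $\mathrm{BZ}\subset\mathcal M$ be the set of points with $|z_i|=1$ for all $i$, and let $\Sigma_{\mathrm{PBC}}=\{E : (\mathbf z,E)\in \mathrm{BZ}\}$. A saddle point is a point $(\mathbf z_s,E_s)\in\mathcal M$ at which $\partial_{z_i}\det(E_s-H(\mathbf z))|_{\mathbf z=\mathbf z_s}=0$ for all $i$. Let $h=\operatorname{Im}E$. Where $\partial_E\det(E-H(\mathbf z))\ne0$, $E$ is locally a holomorphic function of $\mathbf z$ on $\mathcal M$, and $\nabla h$ denotes the gradient of $h$ in the real coordinates $\operatorname{Re}z_i,\operatorname{Im}z_i$. An ascending flow line is a curve on $\mathcal M$, through such points with $\nabla h\neq0$,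 that solves $\dot{\mathbf z}=\nabla h/|\nabla h|^2$. The ascending manifold of a saddle point consists of the saddle point and of all points on ascending flow lines that emanate from it. It is parametrized by points $P(t,\boldsymbol\xi)$, where $\boldsymbol\xi\in S^{d-1}$ labels the flow lines and $t>0$ is the flow time ($P\to(\mathbf z_s,E_s)$ as $t\to0$): $t\boldsymbol\xi\mapsto P(t,\boldsymbol\xi)$ is a continuous bijection from an open neighbourhood of $0\in\mathbb R^d$, star-shaped about $0$, onto the ascending manifold, and a smooth immersion away from $0$. Write $\boldsymbol\mu(t,\boldsymbol\xi)=(\log|z_1|,\dots,\log|z_d|)$ at $P(t,\boldsymbol\xi)$, so that $\boldsymbol\mu=0$ exactly where the ascending manifold hits the BZ. The saddle point is relevant for the BZ integral if it has such a parametrization and its weight, the signed number of hits of the BZ by its ascending manifold, is nonzero. That is, at least one of the following holds: (a) the saddle point does not lie on the BZ, there are finitely many hits, all with $\det\frac{\partial\boldsymbol\mu}{\partial(t,\boldsymbol\xi)}\ne0$, and $\sum_{\text{hits}}\operatorname{sgn}\det\frac{\partial\boldsymbol\mu}{\partial(t,\boldsymbol\xi)}\neq0$; (b) for some $t>0$ up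 to which all flow lines exist and with $\operatorname{Im}E_s+t>\max\operatorname{Im}\Sigma_{\mathrm{PBC}}$, the winding number around the origin of $\boldsymbol\xi\mapsto\boldsymbol\mu(t,\boldsymbol\xi)$ is nonzero. With $\hat{\boldsymbol\mu}=\boldsymbol\mu/\|\boldsymbol\mu\|$ and $A_{d-1}$ the area of $S^{d-1}$, this number is $\frac1{A_{d-1}}\int_{S^{d-1}}\det(\hat{\boldsymbol\mu},\partial_1\hat{\boldsymbol\mu},\dots,\partial_{d-1}\hat{\boldsymbol\mu})\,\mathrm d\boldsymbol\xi$, with the derivatives taken in an oriented orthonormal tangent frame; for $d=1$ it is $\tfrac12(\operatorname{sgn}\mu(t,+1)-\operatorname{sgn}\mu(t,-1))$. Then: 1. If a saddle point $(\mathbf z_s,E_s)$ is relevant, then $E_s+it\in\Sigma_{\mathrm{PBC}}$ for at least one real $t\ge0$. 2. $\max_{E\in\Sigma_{\mathrm{PBC}}}\operatorname{Im}E$ exists, and every relevant saddle point satisfies $\operatorname{Im}E_s\le\max_{E\in\Sigma_{\mathrm{PBC}}}\operatorname{Im}E$. -/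

import Mathlib

open scoped ContDiff

noncomputable section

namespace LatticeModel

/-- A finite-range hopping model with `N` bands on `ℤ^d`: finitely many nonzero `N × N` hopping
matrices, indexed by the hopping vector. -/
abbrev Hopping (d N : ℕ) : Type := (Fin d → ℤ) →₀ Matrix (Fin N) (Fin N) ℂ

/-- Points `(z, E)` of `ℂ^d × ℂ`. -/
abbrev Pt (d : ℕ) : Type := (Fin d → ℂ) × ℂ

/-- Real `d`-space with the Euclidean norm; it carries the polar coordinates `x = t • ξ`
(`t > 0`, `‖ξ‖ = 1`) of ascending manifolds, and the vectors `μ`. -/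
abbrev Eucl (d : ℕ) : Type := EuclideanSpace ℝ (Fin d)

variable {d N : ℕ}

/-- The Hamiltonian `H(z) = ∑ₙ z₁^n₁ ⋯ z_d^n_d Tₙ`, a matrix of Laurent polynomials. -/
def hamiltonian (T : Hopping d N) (z : Fin d → ℂ) : Matrix (Fin N) (Fin N) ℂ :=
  T.sum fun n A => (∏ i, z i ^ n i) • A

/-- `det (E - H(z))`. -/
def charDet (T : Hopping d N) (P : Pt d) : ℂ :=
  (P.2 • (1 : Matrix (Fin N) (Fin N) ℂ) - hamiltonian T P.1).det

/-- The energy surface `𝓜 = {(z, E) | det (E - H(z)) = 0, all z_i ≠ 0}`. -/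
def energySurface (T : Hopping d N) : Set (Pt d) :=
  {P | (∀ i, P.1 i ≠ 0) ∧ charDet T P = 0}

/-- The (multi-band) Brillouin zone: the points of `𝓜` with `|z_i| = 1` for all `i`. -/
def brillouinZone (T : Hopping d N) : Set (Pt d) :=
  {P | P ∈ energySurface T ∧ ∀ i, ‖P.1 i‖ = 1}

/-- The PBC spectrum `Σ_PBC = E(BZ)`. -/
def pbcSpectrum (T : Hopping d N) : Set ℂ :=
  Prod.snd '' brillouinZone T

/-- `∂/∂z_i det (E - H(z))`. -/
def charDetDz (T : Hopping d N) (P : Pt d) (i : Fin d) : ℂ :=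
  deriv (fun w : ℂ => charDet T (Function.update P.1 i w, P.2)) (P.1 i)

/-- `∂/∂E det (E - H(z))`. -/
def charDetDE (T : Hopping d N) (P : Pt d) : ℂ :=
  deriv (fun e : ℂ => charDet T (P.1, e)) P.2

/-- A saddle point `(z_s, E_s)`: `det (E_s - H(z_s)) = 0` and `∂_z det (E_s - H(z)) = 0` at `z_s`. -/
def IsSaddlePoint (T : Hopping d N) (P : Pt d) : Prop :=
  P ∈ energySurface T ∧ ∀ i, charDetDz T P i = 0

/-- The derivative `∂E/∂z_i` along `𝓜`, by implicit differentiation of `det (E - H(z)) = 0`;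
meaningful at the points where `∂_E det (E - H(z)) ≠ 0`, near which `E` is a holomorphic
function of `z`. -/
def bandDeriv (T : Hopping d N) (P : Pt d) (i : Fin d) : ℂ :=
  -charDetDz T P i / charDetDE T P

/-- The gradient `∇h` of `h = Im E` with respect to the `2d` real coordinates `Re z_i, Im z_i`,
written as a complex vector. As `dh(v) = Im (∑ ∂_i E v_i) = Re (∑ conj (∇h)_i v_i)`, its
components are `I * conj (∂_i E)`. -/
def gradIm (T : Hopping d N) (P : Pt d) (i : Fin d) : ℂ :=
  Complex.I * (starRingEnd ℂ) (bandDeriv T P i)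

/-- `‖∇h‖²`. -/
def gradImNormSq (T : Hopping d N) (P : Pt d) : ℝ :=
  ∑ i, ‖gradIm T P i‖ ^ 2

/-- `γ` is, on the set `s` of times, an ascending gradient flow line on `𝓜`: it is a
differentiable curve in `𝓜`, through points near which `E` is a function of `z` and `∇h ≠ 0`,
with `dz/dt = ∇h / ‖∇h‖²`. -/
def IsAscendingFlowLine (T : Hopping d N) (γ : ℝ → Pt d) (s : Set ℝ) : Prop :=
  ∀ t ∈ s, γ t ∈ energySurface T ∧ charDetDE T (γ t) ≠ 0 ∧ gradImNormSq T (γ t) ≠ 0 ∧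
    DifferentiableAt ℝ (fun u => (γ u).2) t ∧
    HasDerivAt (fun u => (γ u).1)
      (fun i => gradIm T (γ t) i / (gradImNormSq T (γ t) : ℂ)) t

/-- The ascending manifold of `P`: the point `P`, and all points on ascending flow lines that
emanate from `P`. -/
def ascendingManifold (T : Hopping d N) (P : Pt d) : Set (Pt d) :=
  {Q | Q = P ∨ ∃ (γ : ℝ → Pt d) (a s : ℝ), 0 < s ∧ s < a ∧
    IsAscendingFlowLine T γ (Set.Ioo 0 a) ∧
    Filter.Tendsto γ (nhdsWithin 0 (Set.Ioi 0)) (nhds P) ∧ γ s = Q}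

/-- A parametrization `P(t, ξ) = toFun (t • ξ)` of the whole ascending manifold of `P` by the flow
time `t` and the label `ξ ∈ S^{d-1}` of the flow line. The flow line of `ξ` exists for the times
`t` with `t • ξ ∈ domain`; it may have a finite life time. -/
structure AscendingParam (T : Hopping d N) (P : Pt d) where
  domain : Set (Eucl d)
  toFun : Eucl d → Pt d
  isOpen_domain : IsOpen domain
  zero_mem : (0 : Eucl d) ∈ domain
  starConvex_domain : StarConvex ℝ 0 domain
  map_zero : toFun 0 = P
  continuousOn : ContinuousOn toFun domain
  smooth : ContDiffOn ℝ ∞ toFun (domain \ {0})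
  immersion : ∀ x ∈ domain \ {0}, Function.Injective (fderiv ℝ toFun x)
  flowLine : ∀ ξ : Eucl d, ‖ξ‖ = 1 →
    IsAscendingFlowLine T (fun t => toFun (t • ξ)) {t | 0 < t ∧ t • ξ ∈ domain}
  injOn : Set.InjOn toFun domain
  image_eq : toFun '' domain = ascendingManifold T P

/-- `μ_i = log |z_i|`; on `𝓜`, the Brillouin zone is the set `μ = 0`. -/
def logModulus (P : Pt d) : Eucl d :=
  WithLp.toLp 2 fun i => Real.log ‖P.1 i‖

/-- The extension of `ξ ↦ F ξ / ‖F ξ‖`, from the unit sphere, which is homogeneous of degree one. -/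
def conicalExtension (F : Eucl d → Eucl d) (x : Eucl d) : Eucl d :=
  (‖x‖ * ‖F (‖x‖⁻¹ • x)‖⁻¹) • F (‖x‖⁻¹ • x)

/-- The winding number around the origin of the restriction of `F` to `S^{d-1}`,
`(1 / A_{d-1}) ∫_{S^{d-1}} det (F̂, ∂₁ F̂, …, ∂_{d-1} F̂)` with `F̂ = F / ‖F‖`.
In an orthonormal frame `ξ, e₁, …, e_{d-1}` at `ξ ∈ S^{d-1}` the columns of the derivative of
`conicalExtension F` are `F̂, ∂₁ F̂, …, ∂_{d-1} F̂`. For `d = 1` the value is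
`(sgn F(1) - sgn F(-1)) / 2`. -/
def windingNumber (F : Eucl d → Eucl d) : ℝ :=
  ((MeasureTheory.volume : MeasureTheory.Measure (Eucl d)).toSphere.real Set.univ)⁻¹ *
    ∫ ξ : Metric.sphere (0 : Eucl d) 1, (fderiv ℝ (conicalExtension F) (ξ : Eucl d)).det
      ∂(MeasureTheory.volume : MeasureTheory.Measure (Eucl d)).toSphere

namespace AscendingParam

variable {T : Hopping d N} {P : Pt d}

/-- `μ` as a function on the parameter space. -/
def mu (A : AscendingParam T P) (x : Eucl d) : Eucl d :=
  logModulus (A.toFun x)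

/-- The parameters at which the ascending manifold hits the Brillouin zone. -/
def hits (A : AscendingParam T P) : Set (Eucl d) :=
  {x | x ∈ A.domain ∧ A.toFun x ∈ brillouinZone T}

/-- The weight of the saddle point as the sum of the orientations `sgn det ∂μ/∂(t, ξ)` over all
hits of the Brillouin zone by the ascending flow. -/
def hitWeight (A : AscendingParam T P) : ℤ :=
  ∑ᶠ x ∈ A.hits, (SignType.sign (fderiv ℝ A.mu x).det : ℤ)

/-- The hits are finitely many and transversal, and the saddle point itself is not one of them. -/
def HasRegularHits (A : AscendingParam T P) : Prop :=
  P ∉ brillouinZone T ∧ A.hits.Finite ∧ ∀ x ∈ A.hits, (fderiv ℝ A.mu x).det ≠ 0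

/-- The winding number `w(t)` of `ξ ↦ μ(t, ξ)` around the origin. -/
def windingAt (A : AscendingParam T P) (t : ℝ) : ℝ :=
  windingNumber fun ξ => A.mu (t • ξ)

/-- All ascending flow lines exist up to time `t`, and at time `t` they have passed the level
`max_BZ Im E`, so that they meet the Brillouin zone neither at time `t` nor later. -/
def IsFinalTime (A : AscendingParam T P) (t : ℝ) : Prop :=
  0 < t ∧ Metric.closedBall 0 t ⊆ A.domain ∧ ∀ E ∈ pbcSpectrum T, E.im < P.2.im + t

end AscendingParam

/-- `P` is relevant: it has nonzero weight, that is, the signed number of hits of the Brillouin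
zone by its ascending manifold is nonzero, where the weight is computed either as the sum of the
orientations of the hits, or as the winding number of `μ(t, ·)` at late `t`.
(If all flow lines live forever, the latter is `lim_{t → ∞} w(t) ≠ 0`. The choice of the
parametrization affects only the overall sign of the weight.) -/
def IsRelevant (T : Hopping d N) (P : Pt d) : Prop :=
  ∃ A : AscendingParam T P,
    (A.HasRegularHits ∧ A.hitWeight ≠ 0) ∨ ∃ t, A.IsFinalTime t ∧ A.windingAt t ≠ 0

end LatticeModel

end

/-!
Along an ascending flow line the implicitly differentiated energy has velocity `i`, so the flow
line passes the point of energy `E_s + i t` at time `t`, and a single hit of the Brillouin zone by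
the ascending manifold puts some `E_s + i t` with `t ≥ 0` into `Σ_PBC`. The maximum of `Im E` exists
because the Brillouin zone is compact and nonempty.

A nonzero sum over the hits has at least one summand. For the winding number, suppose that `μ` has
no zero on the ball of radius `t`. The winding number is the average over the unit ball of the
Jacobian of the cone over `μ / ‖μ‖` (polar coordinates). The Jacobian is a null Lagrangian: for
Lipschitz `G` and large `r` the map `r + G` is bijective, so `∫_B det (r + DG)` is the volume of the
image of `B`, which depends only on the values of `G` off `B`; and `det DG` is a linear combination
of finitely many `det (r + DG)`. Hence the cone may be replaced on the ball by `μ / ‖μ‖` itself,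
whose Jacobian vanishes because its norm is constant. As `μ` is only continuous at the saddle point,
it is first smoothed there without creating a zero.
-/

open MeasureTheory Set Filter Topology Metric
open scoped NNReal

section DeterminantShift

theorem exists_det_eq_sum_mul_det_smul_one_add {K V : Type*} [Field K] [AddCommGroup V]
    [Module K V] [FiniteDimensional K V] {s : Finset K} (hs : Module.finrank K V < s.card) :
    ∃ w : K → K, ∀ A : V →ₗ[K] V,
      LinearMap.det A = ∑ r ∈ s, w r * LinearMap.det (r • 1 + A) := by
  classical
  refine ⟨fun r => (Lagrange.basis s id r).eval 0, fun A => ?_⟩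
  have eval_charpoly_neg : ∀ r, (-A).charpoly.eval r = LinearMap.det (r • 1 + A) := fun r => by
    rw [LinearMap.eval_charpoly, sub_neg_eq_add, Algebra.algebraMap_eq_smul_one]
  have degree_lt : (-A).charpoly.degree < s.card := by
    rw [Polynomial.degree_eq_natDegree (LinearMap.charpoly_monic _).ne_zero,
      LinearMap.charpoly_natDegree]
    exact_mod_cast hs
  have interpolation := congrArg (Polynomial.eval 0)
    (Lagrange.eq_interpolate (Function.injective_id.injOn (s := (s : Set K))) degree_lt)
  simpa only [Lagrange.interpolate_apply, Polynomial.eval_finsetSum, Polynomial.eval_mul,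
    Polynomial.eval_C, id_eq, eval_charpoly_neg, zero_smul, zero_add, mul_comm (LinearMap.det _)]
    using interpolation

variable {E : Type*} [NormedAddCommGroup E] [NormedSpace ℝ E]

theorem bijective_smul_add_of_lipschitzWith [CompleteSpace E] {K : ℝ≥0} {G : E → E}
    (hG : LipschitzWith K G) {c : ℝ} (hc : K < c) : Function.Bijective fun x => c • x + G x := by
  lift c to ℝ≥0 using K.2.trans hc.le
  have hc : K < c := mod_cast hc
  have hc0 : (c : ℝ) ≠ 0 := (K.2.trans_lt hc).ne'
  refine (Function.bijective_iff_existsUnique _).2 fun y => ?_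
  have contracting : ContractingWith (c⁻¹ * K) fun x => (c : ℝ)⁻¹ • (y - G x) := by
    refine ⟨(inv_mul_lt_one₀ (pos_of_gt hc)).2 hc, LipschitzWith.of_dist_le_mul fun x x' => ?_⟩
    rw [dist_smul₀, dist_sub_left, NNReal.coe_mul, NNReal.coe_inv, mul_assoc,
      Real.norm_of_nonneg (by positivity)]
    gcongr
    exact hG.dist_le_mul x x'
  have isFixedPt_iff : ∀ x, (c : ℝ)⁻¹ • (y - G x) = x ↔ (c : ℝ) • x + G x = y := fun x => by
    rw [inv_smul_eq_iff₀ hc0, sub_eq_iff_eq_add, eq_comm]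
  exact ⟨contracting.fixedPoint, (isFixedPt_iff _).1 contracting.fixedPoint_isFixedPt,
    fun x hx => contracting.fixedPoint_unique ((isFixedPt_iff x).2 hx)⟩

variable [FiniteDimensional ℝ E]

theorem det_smul_id_add_pos {c : ℝ} {A : E →L[ℝ] E} (hA : ‖A‖ < c) :
    0 < (c • ContinuousLinearMap.id ℝ E + A).det := by
  let f : (E →L[ℝ] E) → ℝ := fun B => (c • ContinuousLinearMap.id ℝ E + B).det
  have f_ne_zero : ∀ B ∈ ball (0 : E →L[ℝ] E) c, f B ≠ 0 := fun B hB =>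
    have bijective := bijective_smul_add_of_lipschitzWith B.lipschitz (mem_ball_zero_iff.1 hB)
    (LinearEquiv.ofBijective ((c • ContinuousLinearMap.id ℝ E + B : E →L[ℝ] E) : E →ₗ[ℝ] E)
      bijective).isUnit_det'.ne_zero
  have f_zero_pos : 0 < f 0 := by
    have hc : 0 < c := (norm_nonneg A).trans_lt hA
    have : f 0 = c ^ Module.finrank ℝ E := by simp [f, ContinuousLinearMap.det]
    exact this ▸ pow_pos hc _
  by_contra! f_nonpos
  have f_continuous : Continuous f := ContinuousLinearMap.continuous_det.comp (by fun_prop)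
  obtain ⟨B, hB, hB0⟩ := (convex_ball (0 : E →L[ℝ] E) c).isPreconnected.intermediate_value
    (mem_ball_zero_iff.2 hA) (mem_ball_self ((norm_nonneg A).trans_lt hA))
    f_continuous.continuousOn ⟨f_nonpos, f_zero_pos.le⟩
  exact f_ne_zero B hB hB0

end DeterminantShift

section NullLagrangian

variable {E : Type*} [NormedAddCommGroup E] [NormedSpace ℝ E] [FiniteDimensional ℝ E]
  [MeasurableSpace E] [BorelSpace E] {μ : Measure E} {K : ℝ≥0} {B : Set E}

theorem integrableOn_det_smul_id_add_fderiv {G : E → E} (hG : LipschitzWith K G) (c : ℝ)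
    (hμB : μ B ≠ ⊤) :
    IntegrableOn (fun x => (c • ContinuousLinearMap.id ℝ E + fderiv ℝ G x).det) B μ := by
  have det_continuous : Continuous fun A : E →L[ℝ] E =>
      (c • ContinuousLinearMap.id ℝ E + A).det :=
    ContinuousLinearMap.continuous_det.comp (by fun_prop)
  obtain ⟨C, hC⟩ := (isCompact_closedBall (0 : E →L[ℝ] E) K).exists_bound_of_continuousOn
    det_continuous.continuousOn
  exact .of_bound hμB.lt_top
    (det_continuous.measurable.comp (measurable_fderiv ℝ G)).aestronglyMeasurable C
    (.of_forall fun x => hC _ (mem_closedBall_zero_iff.2 (norm_fderiv_le_of_lipschitz ℝ hG)))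

variable [μ.IsAddHaarMeasure]

theorem addHaar_image_eq_zero_of_lipschitzWith {f : E → E} (hf : LipschitzWith K f)
    (hB : μ B = 0) : μ (f '' B) = 0 := by
  have hausdorff_null : μH[Module.finrank ℝ E] B = 0 :=
    Measure.absolutelyContinuous_isAddHaarMeasure _ μ hB
  have hausdorff_image_null : μH[Module.finrank ℝ E] (f '' B) = 0 := by
    simpa only [hausdorff_null, mul_zero, nonpos_iff_eq_zero] using
      hf.hausdorffMeasure_image_le (Nat.cast_nonneg (Module.finrank ℝ E)) B
  exact Measure.absolutelyContinuous_isAddHaarMeasure μ _ hausdorff_image_null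

theorem lintegral_abs_det_fderiv_eq_addHaar_image_of_lipschitzWith {f : E → E}
    (hf : LipschitzWith K f) (hB : MeasurableSet B) (hinj : InjOn f B) :
    ∫⁻ x in B, ENNReal.ofReal |(fderiv ℝ f x).det| ∂μ = μ (f '' B) := by
  set D : Set E := {x | DifferentiableAt ℝ f x}
  have hD : MeasurableSet D := measurableSet_of_differentiableAt ℝ f
  have hDc : μ (B \ D) = 0 := measure_mono_null (fun x hx => hx.2) (hf.ae_differentiableAt (μ := μ))
  have domain_ae_eq : (B ∩ D : Set E) =ᵐ[μ] B := inter_ae_eq_left_of_ae_eq_univ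
    (eventuallyEq_univ.2 hf.ae_differentiableAt)
  have image_ae_eq : (f '' (B ∩ D) : Set E) =ᵐ[μ] f '' B := by
    have image_null := addHaar_image_eq_zero_of_lipschitzWith hf hDc
    have := union_ae_eq_left_of_ae_eq_empty (s := f '' (B ∩ D)) (ae_eq_empty.2 image_null)
    rw [← image_union, inter_union_sdiff] at this
    exact this.symm
  rw [← measure_congr image_ae_eq, ← setLIntegral_congr domain_ae_eq]
  exact lintegral_abs_det_fderiv_eq_addHaar_image μ (hB.inter hD)
    (fun x hx => hx.2.hasFDerivAt.hasFDerivWithinAt) (hinj.mono inter_subset_left)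

theorem integral_det_fderiv_smul_add_eq_measureReal_image {G : E → E} (hG : LipschitzWith K G)
    {c : ℝ} (hc : K < c) (hB : MeasurableSet B) :
    ∫ x in B, (c • ContinuousLinearMap.id ℝ E + fderiv ℝ G x).det ∂μ =
      μ.real ((fun x => c • x + G x) '' B) := by
  have fderiv_eq : ∀ᵐ x ∂μ.restrict B,
      fderiv ℝ (fun x => c • x + G x) x = c • ContinuousLinearMap.id ℝ E + fderiv ℝ G x := by
    filter_upwards [ae_restrict_of_ae hG.ae_differentiableAt] with x hx
    exact (((hasFDerivAt_id x).const_smul c).add hx.hasFDerivAt).fderiv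
  have det_pos : ∀ x, 0 < (c • ContinuousLinearMap.id ℝ E + fderiv ℝ G x).det := fun x =>
    det_smul_id_add_pos ((norm_fderiv_le_of_lipschitz ℝ hG).trans_lt hc)
  have injOn : InjOn (fun x => c • x + G x) B :=
    (bijective_smul_add_of_lipschitzWith hG hc).injective.injOn
  rw [integral_eq_lintegral_of_nonneg_ae (.of_forall fun x => (det_pos x).le), measureReal_def,
    ← lintegral_abs_det_fderiv_eq_addHaar_image_of_lipschitzWith
      ((lipschitzWith_smul c).add hG) hB injOn]
  · congr 1
    refine lintegral_congr_ae ?_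
    filter_upwards [fderiv_eq] with x hx
    rw [hx, abs_of_pos (det_pos x)]
  · exact (ContinuousLinearMap.continuous_det.measurable.comp
      ((measurable_fderiv ℝ G).const_add _)).aestronglyMeasurable

theorem exists_integral_det_fderiv_eq_sum_measureReal_image (K : ℝ≥0) (hB : MeasurableSet B)
    (hμB : μ B ≠ ⊤) : ∃ (s : Finset ℝ) (w : ℝ → ℝ), (∀ r ∈ s, K < r) ∧
      ∀ G : E → E, LipschitzWith K G → ∫ x in B, (fderiv ℝ G x).det ∂μ =
        ∑ r ∈ s, w r * μ.real ((fun x => r • x + G x) '' B) := by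
  obtain ⟨s, hs, card_s⟩ :=
    (Ioi_infinite (K : ℝ)).exists_subset_card_eq (Module.finrank ℝ E + 1)
  obtain ⟨w, hw⟩ := exists_det_eq_sum_mul_det_smul_one_add (V := E) (s := s) (by omega)
  refine ⟨s, w, fun r hr => hs hr, fun G hG => ?_⟩
  calc ∫ x in B, (fderiv ℝ G x).det ∂μ
      = ∫ x in B, ∑ r ∈ s, w r * (r • ContinuousLinearMap.id ℝ E + fderiv ℝ G x).det ∂μ :=
        integral_congr_ae (.of_forall fun x => hw (fderiv ℝ G x))
    _ = ∑ r ∈ s, w r * ∫ x in B, (r • ContinuousLinearMap.id ℝ E + fderiv ℝ G x).det ∂μ := by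
        rw [integral_finsetSum _ fun r _ => ?_]
        · simp_rw [integral_const_mul]
        · exact (integrableOn_det_smul_id_add_fderiv hG r hμB).const_mul _
    _ = ∑ r ∈ s, w r * μ.real ((fun x => r • x + G x) '' B) :=
        Finset.sum_congr rfl fun r hr => by
          rw [integral_det_fderiv_smul_add_eq_measureReal_image hG (hs hr) hB]

theorem integral_det_fderiv_eq_of_eqOn_compl {G₁ G₂ : E → E} (h₁ : LipschitzWith K G₁)
    (h₂ : LipschitzWith K G₂) (hB : MeasurableSet B) (hμB : μ B ≠ ⊤) (heq : EqOn G₁ G₂ Bᶜ) :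
    ∫ x in B, (fderiv ℝ G₁ x).det ∂μ = ∫ x in B, (fderiv ℝ G₂ x).det ∂μ := by
  obtain ⟨s, w, hs, hsum⟩ :=
    exists_integral_det_fderiv_eq_sum_measureReal_image (μ := μ) K hB hμB
  have image_eq : ∀ r ∈ s, (fun x => r • x + G₁ x) '' B = (fun x => r • x + G₂ x) '' B := by
    intro r hr
    rw [← compl_inj_iff, ← image_compl_eq (bijective_smul_add_of_lipschitzWith h₁ (hs r hr)),
      ← image_compl_eq (bijective_smul_add_of_lipschitzWith h₂ (hs r hr))]
    exact image_congr fun x hx => by rw [heq hx]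
  rw [hsum G₁ h₁, hsum G₂ h₂]
  exact Finset.sum_congr rfl fun r hr => by rw [image_eq r hr]

end NullLagrangian

section Perspective

variable {E F : Type*} [NormedAddCommGroup E] [NormedSpace ℝ E] [NormedAddCommGroup F]
  [NormedSpace ℝ F] {m : E → ℝ}

/-- The rescaling `x ↦ m x • u (x / m x)` of a map `u` of the unit ball by a gauge `m ≥ ‖·‖`. The
gauge `‖·‖` gives the cone over the values of `u` on the unit sphere; the gauge `max 1 ‖·‖` extends
`u` by this cone outside the ball. -/
noncomputable def perspective (m : E → ℝ) (u : E → F) (x : E) : F :=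
  m x • u ((m x)⁻¹ • x)

theorem norm_inv_smul_le_one (hm : ∀ x, ‖x‖ ≤ m x) (x : E) : ‖(m x)⁻¹ • x‖ ≤ 1 := by
  have hmx : 0 ≤ m x := (norm_nonneg x).trans (hm x)
  rw [norm_smul, norm_inv, Real.norm_of_nonneg hmx]
  exact inv_mul_le_one_of_le₀ (hm x) hmx

theorem mul_norm_inv_smul_sub_inv_smul_le (hm : ∀ x, ‖x‖ ≤ m x) (hm1 : LipschitzWith 1 m)
    (x y : E) : m y * ‖(m x)⁻¹ • x - (m y)⁻¹ • y‖ ≤ 2 * ‖x - y‖ := by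
  have smul_inv_smul : ∀ x, m x • (m x)⁻¹ • x = x := fun x => by
    rcases eq_or_ne (m x) 0 with h | h
    · rw [norm_le_zero_iff.1 ((hm x).trans h.le), smul_zero, smul_zero]
    · exact smul_inv_smul₀ h x
  calc m y * ‖(m x)⁻¹ • x - (m y)⁻¹ • y‖
      = ‖m y • ((m x)⁻¹ • x - (m y)⁻¹ • y)‖ := by
        rw [norm_smul, Real.norm_of_nonneg ((norm_nonneg y).trans (hm y))]
    _ = ‖(x - y) - (m x - m y) • (m x)⁻¹ • x‖ := by
        rw [smul_sub, sub_smul, smul_inv_smul, smul_inv_smul]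
        congr 1
        abel
    _ ≤ ‖x - y‖ + ‖m x - m y‖ * ‖(m x)⁻¹ • x‖ := by
        rw [← norm_smul]
        exact norm_sub_le _ _
    _ ≤ ‖x - y‖ + ‖x - y‖ * 1 := by
        gcongr
        · simpa only [NNReal.coe_one, one_mul] using hm1.norm_sub_le x y
        · exact norm_inv_smul_le_one hm x
    _ = 2 * ‖x - y‖ := by ring

theorem lipschitzWith_perspective {u : E → F} {C L : ℝ≥0}
    (hu : LipschitzOnWith L u (closedBall 0 1)) (huC : ∀ x ∈ closedBall (0 : E) 1, ‖u x‖ ≤ C)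
    (hm : ∀ x, ‖x‖ ≤ m x) (hm1 : LipschitzWith 1 m) :
    LipschitzWith (C + 2 * L) (perspective m u) := by
  refine LipschitzWith.of_dist_le_mul fun x y => ?_
  rw [dist_eq_norm, dist_eq_norm]
  have mem_ball : ∀ x, (m x)⁻¹ • x ∈ closedBall (0 : E) 1 := fun x =>
    mem_closedBall_zero_iff.2 (norm_inv_smul_le_one hm x)
  have hmy : 0 ≤ m y := (norm_nonneg y).trans (hm y)
  calc ‖m x • u ((m x)⁻¹ • x) - m y • u ((m y)⁻¹ • y)‖
      = ‖(m x - m y) • u ((m x)⁻¹ • x) + m y • (u ((m x)⁻¹ • x) - u ((m y)⁻¹ • y))‖ := by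
        congr 1
        module
    _ ≤ ‖m x - m y‖ * ‖u ((m x)⁻¹ • x)‖ + m y * ‖u ((m x)⁻¹ • x) - u ((m y)⁻¹ • y)‖ := by
        refine (norm_add_le _ _).trans_eq ?_
        rw [norm_smul, norm_smul, Real.norm_of_nonneg hmy]
    _ ≤ ‖x - y‖ * C + m y * (L * ‖(m x)⁻¹ • x - (m y)⁻¹ • y‖) := by
        gcongr
        · simpa only [NNReal.coe_one, one_mul] using hm1.norm_sub_le x y
        · exact huC _ (mem_ball x)
        · exact hu.norm_sub_le (mem_ball x) (mem_ball y)
    _ = ‖x - y‖ * C + L * (m y * ‖(m x)⁻¹ • x - (m y)⁻¹ • y‖) := by ring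
    _ ≤ ‖x - y‖ * C + L * (2 * ‖x - y‖) := add_le_add_right
        (mul_le_mul_of_nonneg_left (mul_norm_inv_smul_sub_inv_smul_le hm hm1 x y) L.2) _
    _ = ↑(C + 2 * L) * ‖x - y‖ := by
        push_cast
        ring

theorem setIntegral_det_fderiv_perspective_norm [FiniteDimensional ℝ E] [MeasurableSpace E]
    [BorelSpace E] (μ : Measure E) [μ.IsAddHaarMeasure] {u : E → E} {L : ℝ≥0}
    (hu : LipschitzOnWith L u (closedBall 0 1)) :
    ∫ x in ball 0 1, (fderiv ℝ (perspective (‖·‖) u) x).det ∂μ =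
      ∫ x in ball 0 1, (fderiv ℝ u x).det ∂μ := by
  obtain ⟨C, hC⟩ := (isCompact_closedBall (0 : E) 1).exists_bound_of_continuousOn hu.continuousOn
  have huC : ∀ x ∈ closedBall (0 : E) 1, ‖u x‖ ≤ C.toNNReal := fun x hx =>
    (hC x hx).trans (Real.le_coe_toNNReal C)
  have cone_lipschitz : LipschitzWith (C.toNNReal + 2 * L) (perspective (‖·‖) u) :=
    lipschitzWith_perspective hu huC (fun _ => le_rfl) lipschitzWith_one_norm
  have extension_lipschitz : LipschitzWith (C.toNNReal + 2 * L) (perspective (max 1 ‖·‖) u) :=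
    lipschitzWith_perspective hu huC (fun _ => le_max_right _ _)
      (lipschitzWith_one_norm.const_max 1)
  have eqOn_compl : EqOn (perspective (‖·‖) u) (perspective (max 1 ‖·‖) u) (ball 0 1)ᶜ :=
    fun x hx => by
      have : 1 ≤ ‖x‖ := by simpa only [mem_compl_iff, mem_ball_zero_iff, not_lt] using hx
      simp only [perspective, max_eq_right this]
  have eqOn_ball : EqOn (perspective (max 1 ‖·‖) u) u (ball 0 1) := fun x hx => by
    simp only [perspective, max_eq_left (mem_ball_zero_iff.1 hx).le, inv_one, one_smul]
  rw [integral_det_fderiv_eq_of_eqOn_compl cone_lipschitz extension_lipschitz measurableSet_ball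
    measure_ball_lt_top.ne eqOn_compl]
  refine setIntegral_congr_fun measurableSet_ball fun x hx => ?_
  simp only [(eqOn_ball.eventuallyEq_of_mem (isOpen_ball.mem_nhds hx)).fderiv_eq]

end Perspective

theorem det_fderiv_eq_zero_of_isLocalMax_norm {E : Type*} [NormedAddCommGroup E]
    [InnerProductSpace ℝ E] [FiniteDimensional ℝ E] {u : E → E} {x : E}
    (hu : DifferentiableAt ℝ u x) (hux : u x ≠ 0) (hmax : IsLocalMax (fun y => ‖u y‖) x) :
    (fderiv ℝ u x).det = 0 := by
  have hsq : IsLocalMax (fun y => ‖u y‖ ^ 2) x :=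
    hmax.mono fun y hy => pow_le_pow_left₀ (norm_nonneg _) hy 2
  have inner_fderiv : ∀ v, inner ℝ (u x) (fderiv ℝ u x v) = 0 := fun v => by
    have := congrArg (fun A : E →L[ℝ] ℝ => A v) (hsq.hasFDerivAt_eq_zero hu.hasFDerivAt.norm_sq)
    simpa using this
  by_contra hdet
  obtain ⟨v, hv⟩ : ∃ v, fderiv ℝ u x v = u x :=
    (LinearMap.equivOfDetNeZero _ hdet).surjective (u x)
  exact hux (inner_self_eq_zero.1 (hv ▸ inner_fderiv v))

section ToSphere

variable {E F : Type*} [NormedAddCommGroup E] [NormedSpace ℝ E] [FiniteDimensional ℝ E]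
  [Nontrivial E] [MeasurableSpace E] [BorelSpace E] [NormedAddCommGroup F] [NormedSpace ℝ F]
  (μ : Measure E) [μ.IsAddHaarMeasure] {f : E → F}

theorem integral_toSphere_eq_smul_setIntegral_ball
    (hf : ∀ r : ℝ, 0 < r → ∀ x, f (r • x) = f x) :
    ∫ ξ : sphere (0 : E) 1, f ξ ∂μ.toSphere =
      (Module.finrank ℝ E : ℝ) • ∫ x in ball (0 : E) 1, f x ∂μ := by
  set ν := Measure.volumeIoiPow (Module.finrank ℝ E - 1)
  set I : Set (Ioi (0 : ℝ)) := Iio ⟨1, mem_Ioi.2 one_pos⟩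
  have dim_pos : 0 < Module.finrank ℝ E := Module.finrank_pos
  have measure_I : ν.real I = (Module.finrank ℝ E : ℝ)⁻¹ := by
    rw [measureReal_def, Measure.volumeIoiPow_apply_Iio, ENNReal.toReal_ofReal (by positivity),
      one_pow, Nat.cast_pred dim_pos, sub_add_cancel, one_div]
  have polar : ∫ x in ball (0 : E) 1, f x ∂μ = ν.real I • ∫ ξ : sphere (0 : E) 1, f ξ ∂μ.toSphere :=
    calc ∫ x in ball (0 : E) 1, f x ∂μ
        = ∫ x : ({0}ᶜ : Set E), (ball (0 : E) 1).indicator f x ∂μ.comap (↑) := by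
          rw [integral_subtype_comap (measurableSet_singleton _).compl,
            restrict_compl_singleton, integral_indicator measurableSet_ball]
      _ = ∫ p, (univ ×ˢ I).indicator (fun p : sphere (0 : E) 1 × Ioi (0 : ℝ) => f p.1) p
          ∂μ.toSphere.prod ν := by
          rw [← μ.measurePreserving_homeomorphUnitSphereProd.integral_comp
            (Homeomorph.measurableEmbedding _)]
          refine integral_congr_ae (.of_forall fun x => ?_)
          have hx : 0 < ‖(x : E)‖⁻¹ := inv_pos.2 (norm_pos_iff.2 x.2)
          simp only [indicator, mem_ball_zero_iff, mem_prod, mem_univ, true_and, I, mem_Iio,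
            ← Subtype.coe_lt_coe, homeomorphUnitSphereProd_apply_snd_coe,
            homeomorphUnitSphereProd_apply_fst_coe, hf _ hx]
      _ = ∫ p, f p.1 ∂μ.toSphere.prod (ν.restrict I) := by
          rw [integral_indicator (MeasurableSet.univ.prod measurableSet_Iio),
            ← Measure.prod_restrict, Measure.restrict_univ]
      _ = ν.real I • ∫ ξ : sphere (0 : E) 1, f ξ ∂μ.toSphere := by
          rw [integral_fun_fst fun ξ : sphere (0 : E) 1 => f ξ, measureReal_restrict_apply_univ]
  rw [polar, measure_I, smul_inv_smul₀ (by positivity)]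

theorem average_toSphere_eq_setAverage_ball (hf : ∀ r : ℝ, 0 < r → ∀ x, f (r • x) = f x) :
    ⨍ ξ : sphere (0 : E) 1, f ξ ∂μ.toSphere = ⨍ x in ball (0 : E) 1, f x ∂μ := by
  rw [average_eq, setAverage_eq, integral_toSphere_eq_smul_setIntegral_ball μ hf,
    μ.toSphere_real_apply_univ, smul_smul, mul_inv_rev, inv_mul_cancel_right₀]
  exact Nat.cast_ne_zero.2 Module.finrank_pos.ne'

end ToSphere

theorem exists_contDiffAt_ne_zero_eqOn_compl_ball {E F : Type*} [NormedAddCommGroup E]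
    [NormedSpace ℝ E] [HasContDiffBump E] [NormedAddCommGroup F] [NormedSpace ℝ F] {f : E → F}
    {c : E} (hf : ContinuousAt f c) (hc : f c ≠ 0) {r : ℝ} (hr : 0 < r) (n : ℕ∞) :
    ∃ g : E → F, EqOn g f (ball c r)ᶜ ∧ ContDiffAt ℝ n g c ∧
      (∀ x, ContDiffAt ℝ n f x → ContDiffAt ℝ n g x) ∧ ∀ x, f x ≠ 0 → g x ≠ 0 := by
  obtain ⟨δ, hδ, hδf⟩ := Metric.continuousAt_iff.1 hf ‖f c‖ (norm_pos_iff.2 hc)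
  let χ : ContDiffBump c := ⟨min δ r / 2, min δ r, by positivity, half_lt_self (by positivity)⟩
  have χ_eq_zero : ∀ x, min δ r ≤ dist x c → χ x = 0 := fun x hx => χ.zero_of_le_dist hx
  refine ⟨fun x => AffineMap.lineMap (f x) (f c) (χ x), fun x hx => ?_, ?_, fun x hx => ?_,
    fun x hx => ?_⟩
  · have := (min_le_right δ r).trans (not_lt.1 hx)
    simp only [χ_eq_zero x this, AffineMap.lineMap_apply_zero]
  · refine (contDiffAt_const (c := f c)).congr_of_eventuallyEq ?_
    filter_upwards [χ.eventuallyEq_one] with x hx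
    rw [hx, Pi.one_apply, AffineMap.lineMap_apply_one]
  · simp only [AffineMap.lineMap_apply_module']
    exact (χ.contDiffAt.smul (contDiffAt_const.sub hx)).add hx
  · rcases le_or_gt (min δ r) (dist x c) with h | h
    · simpa only [χ_eq_zero x h, AffineMap.lineMap_apply_zero] using hx
    · have hfx : f x ∈ ball (f c) ‖f c‖ := hδf (h.trans_le (min_le_left _ _))
      have hmem : AffineMap.lineMap (f x) (f c) (χ x) ∈ ball (f c) ‖f c‖ :=
        (convex_ball _ _).lineMap_mem hfx (mem_ball_self (norm_pos_iff.2 hc)) ⟨χ.nonneg, χ.le_one⟩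
      exact ne_of_mem_of_not_mem hmem fun h0 => (dist_zero_left (f c) ▸ mem_ball.1 h0).false

theorem fderiv_smul_of_map_smul {E F : Type*} [NormedAddCommGroup E] [NormedSpace ℝ E]
    [NormedAddCommGroup F] [NormedSpace ℝ F] {f : E → F} {r : ℝ} (hr : r ≠ 0)
    (hf : ∀ x, f (r • x) = r • f x) (x : E) : fderiv ℝ f (r • x) = fderiv ℝ f x := by
  have h := fderiv_comp_smul (𝕜 := ℝ) (f := f) (x := x) r
  rw [show (fun x => f (r • x)) = r • f from funext hf, fderiv_const_smul_field] at h
  exact (smul_right_injective _ hr h).symm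

namespace LatticeModel

open NormedSpace (normalize norm_normalize normalize_smul_of_pos)

section WindingNumber

variable {d : ℕ} {f g : Eucl d → Eucl d}

theorem conicalExtension_eq_perspective (f : Eucl d → Eucl d) :
    conicalExtension f = perspective (‖·‖) fun x => normalize (f x) :=
  funext fun _ => mul_smul _ _ _

theorem conicalExtension_smul (f : Eucl d → Eucl d) {r : ℝ} (hr : 0 < r) (x : Eucl d) :
    conicalExtension f (r • x) = r • conicalExtension f x := by
  rw [conicalExtension_eq_perspective]
  change ‖r • x‖ • normalize (f (normalize (r • x))) = r • ‖x‖ • normalize (f (normalize x))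
  rw [normalize_smul_of_pos hr, norm_smul, Real.norm_of_nonneg hr.le, mul_smul]

theorem conicalExtension_congr (h : EqOn f g (sphere 0 1)) :
    conicalExtension f = conicalExtension g := by
  funext x
  rcases eq_or_ne x 0 with rfl | hx
  · simp only [conicalExtension, norm_zero, zero_mul, zero_smul]
  · have : ‖x‖⁻¹ • x ∈ sphere (0 : Eucl d) 1 := mem_sphere_zero_iff_norm.2 (norm_normalize hx)
    simp only [conicalExtension, h this]

theorem windingNumber_congr (h : EqOn f g (sphere 0 1)) : windingNumber f = windingNumber g := by
  simp only [windingNumber, conicalExtension_congr h]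

theorem windingNumber_eq_setAverage_ball [Nontrivial (Eucl d)] (f : Eucl d → Eucl d) :
    windingNumber f = ⨍ x in ball (0 : Eucl d) 1, (fderiv ℝ (conicalExtension f) x).det := by
  rw [← average_toSphere_eq_setAverage_ball volume fun r hr x => ?_, average_eq]
  · rfl
  · rw [fderiv_smul_of_map_smul hr.ne' (conicalExtension_smul f hr)]

theorem windingNumber_eq_zero_of_contDiffAt
    (hf : ∀ x ∈ closedBall (0 : Eucl d) 1, ContDiffAt ℝ 1 f x)
    (hf0 : ∀ x ∈ closedBall (0 : Eucl d) 1, f x ≠ 0) : windingNumber f = 0 := by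
  have : Nontrivial (Eucl d) := nontrivial_of_ne _ _ (hf0 0 (mem_closedBall_self zero_le_one))
  set u : Eucl d → Eucl d := fun x => normalize (f x)
  have u_contDiffAt : ∀ x ∈ closedBall (0 : Eucl d) 1, ContDiffAt ℝ 1 u x := fun x hx =>
    (((hf x hx).norm ℝ (hf0 x hx)).inv (norm_ne_zero_iff.2 (hf0 x hx))).smul (hf x hx)
  have norm_u : ∀ x ∈ closedBall (0 : Eucl d) 1, ‖u x‖ = 1 := fun x hx =>
    norm_normalize (hf0 x hx)
  obtain ⟨L, hL⟩ := ContDiffOn.exists_lipschitzOnWith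
    (fun x hx => (u_contDiffAt x hx).contDiffWithinAt) one_ne_zero
    (convex_closedBall (0 : Eucl d) 1) (isCompact_closedBall 0 1)
  rw [windingNumber_eq_setAverage_ball, conicalExtension_eq_perspective, setAverage_eq,
    setIntegral_det_fderiv_perspective_norm _ hL,
    setIntegral_eq_zero_of_forall_eq_zero fun x hx => ?_, smul_zero]
  have hx' := ball_subset_closedBall hx
  refine det_fderiv_eq_zero_of_isLocalMax_norm ((u_contDiffAt x hx').differentiableAt one_ne_zero)
    (norm_ne_zero_iff.1 (by rw [norm_u x hx']; exact one_ne_zero)) ?_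
  filter_upwards [isOpen_ball.mem_nhds hx] with y hy
  rw [norm_u x hx', norm_u y (ball_subset_closedBall hy)]

theorem windingNumber_eq_zero_of_continuousAt {t : ℝ} (ht : 0 < t) (hf : ContinuousAt f 0)
    (hf' : ∀ x ∈ closedBall (0 : Eucl d) t, x ≠ 0 → ContDiffAt ℝ 1 f x)
    (hf0 : ∀ x ∈ closedBall (0 : Eucl d) t, f x ≠ 0) : windingNumber (fun ξ => f (t • ξ)) = 0 := by
  obtain ⟨g, g_eqOn, g_contDiffAt_zero, g_contDiffAt, g_ne_zero⟩ :=
    exists_contDiffAt_ne_zero_eqOn_compl_ball hf (hf0 0 (mem_closedBall_self ht.le)) ht 1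
  have smul_mem : ∀ x ∈ closedBall (0 : Eucl d) 1, t • x ∈ closedBall (0 : Eucl d) t := by
    intro x hx
    rw [mem_closedBall_zero_iff] at hx ⊢
    rw [norm_smul, Real.norm_of_nonneg ht.le]
    exact mul_le_of_le_one_right ht.le hx
  have eqOn_sphere : EqOn (fun ξ => f (t • ξ)) (fun ξ => g (t • ξ)) (sphere 0 1) := fun ξ hξ => by
    refine (g_eqOn ?_).symm
    rw [mem_compl_iff, mem_ball_zero_iff, norm_smul, Real.norm_of_nonneg ht.le,
      mem_sphere_zero_iff_norm.1 hξ, mul_one]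
    exact lt_irrefl t
  rw [windingNumber_congr eqOn_sphere]
  refine windingNumber_eq_zero_of_contDiffAt (fun x hx => ?_) fun x hx =>
    g_ne_zero _ (hf0 _ (smul_mem x hx))
  refine ContDiffAt.comp (g := g) x ?_ (contDiff_const_smul t).contDiffAt
  rcases eq_or_ne x 0 with rfl | hx0
  · rwa [smul_zero]
  · exact g_contDiffAt _ (hf' _ (smul_mem x hx) (smul_ne_zero ht.ne' hx0))

end WindingNumber

variable {d N : ℕ} {T : Hopping d N} {P Q : Pt d}

section EnergySurface

theorem hamiltonian_apply (T : Hopping d N) (z : Fin d → ℂ) (a b : Fin N) :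
    hamiltonian T z a b = ∑ n ∈ T.support, (∏ i, z i ^ n i) * T n a b := by
  simp [hamiltonian, Finsupp.sum, Matrix.sum_apply]

theorem differentiableAt_hamiltonian_apply (T : Hopping d N) {z : Fin d → ℂ} (hz : ∀ i, z i ≠ 0)
    (a b : Fin N) : DifferentiableAt ℂ (fun z => hamiltonian T z a b) z := by
  simp_rw [hamiltonian_apply]
  refine DifferentiableAt.fun_sum fun n _ => DifferentiableAt.mul_const ?_ _
  have zpow : ∀ i ∈ Finset.univ, DifferentiableAt ℂ (fun z : Fin d → ℂ => z i ^ n i) z :=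
    fun i _ => (differentiableAt_apply i z).zpow (Or.inl (hz i))
  exact (HasFDerivAt.finsetProd fun i hi => (zpow i hi).hasFDerivAt).differentiableAt

theorem differentiableAt_charDet (T : Hopping d N) (hz : ∀ i, P.1 i ≠ 0) :
    DifferentiableAt ℂ (charDet T) P := by
  have entry : ∀ a b, DifferentiableAt ℂ (fun Q : Pt d => hamiltonian T Q.1 a b) P := fun a b =>
    DifferentiableAt.comp (g := fun z => hamiltonian T z a b) P
      (differentiableAt_hamiltonian_apply T hz a b) differentiableAt_fst
  unfold charDet
  simp_rw [Matrix.det_apply']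
  refine DifferentiableAt.fun_sum fun σ _ => DifferentiableAt.const_mul ?_ _
  exact (HasFDerivAt.finsetProd fun i _ =>
    ((differentiableAt_snd.mul_const _).fun_sub (entry _ _)).hasFDerivAt).differentiableAt

theorem fderiv_charDet_apply (T : Hopping d N) (hz : ∀ i, P.1 i ≠ 0) (v : Fin d → ℂ) (e : ℂ) :
    fderiv ℂ (charDet T) P (v, e) = ∑ i, charDetDz T P i * v i + charDetDE T P * e := by
  have hasFDerivAt := (differentiableAt_charDet T hz).hasFDerivAt
  have partial_z : ∀ i, charDetDz T P i = fderiv ℂ (charDet T) P (Pi.single i 1, 0) := fun i => by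
    have line : HasDerivAt (fun w : ℂ => (Function.update P.1 i w, P.2)) (Pi.single i (1 : ℂ), 0)
        (P.1 i) := (hasDerivAt_update P.1 i (P.1 i)).prodMk (hasDerivAt_const _ _)
    exact (hasFDerivAt.comp_hasDerivAt_of_eq (P.1 i) line (by simp)).deriv
  have partial_E : charDetDE T P = fderiv ℂ (charDet T) P (0, 1) := by
    have line : HasDerivAt (fun w : ℂ => (P.1, w)) ((0 : Fin d → ℂ), (1 : ℂ)) P.2 :=
      (hasDerivAt_const _ _).prodMk (hasDerivAt_id _)
    exact (hasFDerivAt.comp_hasDerivAt_of_eq P.2 line rfl).deriv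
  have decomposition : (v, e) = ∑ i, v i • ((Pi.single i 1, 0) : Pt d) + e • ((0, 1) : Pt d) := by
    ext j
    · simp [Prod.fst_sum, Finset.sum_apply, Pi.single_apply]
    · simp [Prod.snd_sum]
  rw [decomposition, map_add, map_sum, map_smul, ← partial_E]
  simp_rw [map_smul, ← partial_z, smul_eq_mul, mul_comm]

theorem eq_sum_bandDeriv_mul_of_hasDerivAt {γ : ℝ → Pt d} {t : ℝ} {v : Fin d → ℂ} {e : ℂ}
    (hz : ∀ i, (γ t).1 i ≠ 0) (hDE : charDetDE T (γ t) ≠ 0)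
    (hγ : ∀ᶠ u in 𝓝 t, charDet T (γ u) = 0) (hγ' : HasDerivAt γ (v, e) t) :
    e = ∑ i, bandDeriv T (γ t) i * v i := by
  have charDet_hasDerivAt := ((differentiableAt_charDet T hz).hasFDerivAt.restrictScalars
    ℝ).comp_hasDerivAt t hγ'
  have h := charDet_hasDerivAt.unique
    ((EventuallyEq.hasDerivAt_iff hγ).2 (hasDerivAt_const t (0 : ℂ)))
  rw [ContinuousLinearMap.coe_restrictScalars', fderiv_charDet_apply T hz] at h
  simp only [bandDeriv, div_mul_eq_mul_div, neg_mul, ← Finset.sum_div, Finset.sum_neg_distrib]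
  rw [eq_div_iff hDE]
  linear_combination h

end EnergySurface

section AscendingManifold

theorem sum_bandDeriv_mul_gradIm (T : Hopping d N) (P : Pt d) :
    ∑ i, bandDeriv T P i * gradIm T P i = Complex.I * gradImNormSq T P := by
  rw [gradImNormSq, Complex.ofReal_sum, Finset.mul_sum]
  refine Finset.sum_congr rfl fun i _ => ?_
  rw [gradIm, norm_mul, Complex.norm_I, one_mul, RCLike.norm_conj, ← Complex.normSq_eq_norm_sq,
    ← Complex.mul_conj]
  ring

theorem IsAscendingFlowLine.hasDerivAt_energy {γ : ℝ → Pt d} {s : Set ℝ}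
    (h : IsAscendingFlowLine T γ s) {t : ℝ} (hs : s ∈ 𝓝 t) :
    HasDerivAt (fun u => (γ u).2) Complex.I t := by
  obtain ⟨mem_surface, hDE, hgrad, energy_diff, momentum_deriv⟩ := h t (mem_of_mem_nhds hs)
  have charDet_eq_zero : ∀ᶠ u in 𝓝 t, charDet T (γ u) = 0 := by
    filter_upwards [hs] with u hu
    exact (h u hu).1.2
  have deriv_eq := eq_sum_bandDeriv_mul_of_hasDerivAt mem_surface.1 hDE charDet_eq_zero
    (momentum_deriv.prodMk energy_diff.hasDerivAt)
  simp only [← mul_div_assoc, ← Finset.sum_div, sum_bandDeriv_mul_gradIm] at deriv_eq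
  rw [mul_div_cancel_right₀ _ (Complex.ofReal_ne_zero.2 hgrad)] at deriv_eq
  exact deriv_eq ▸ energy_diff.hasDerivAt

theorem IsAscendingFlowLine.energy_eq {γ : ℝ → Pt d} {a s : ℝ}
    (h : IsAscendingFlowLine T γ (Ioo 0 a)) (hP : Tendsto γ (𝓝[>] 0) (𝓝 P)) (hs : 0 < s)
    (hsa : s < a) : (γ s).2 = P.2 + Complex.I * s := by
  have energy_deriv : ∀ t ∈ Ioc 0 s, HasDerivAt (fun u => (γ u).2) Complex.I t := fun t ht =>
    h.hasDerivAt_energy (Ioo_mem_nhds ht.1 (ht.2.trans_lt hsa))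
  have integral_eq := intervalIntegral.integral_eq_sub_of_hasDerivAt_of_tendsto hs
    (fun t ht => energy_deriv t (Ioo_subset_Ioc_self ht)) intervalIntegrable_const
    ((continuous_snd.tendsto P).comp hP)
    ((energy_deriv s ⟨hs, le_rfl⟩).continuousAt.tendsto.mono_left nhdsWithin_le_nhds)
  rw [intervalIntegral.integral_const, sub_zero, Complex.real_smul] at integral_eq
  linear_combination -integral_eq

theorem exists_energy_eq_of_mem_ascendingManifold (hQ : Q ∈ ascendingManifold T P) :
    ∃ t : ℝ, 0 ≤ t ∧ Q.2 = P.2 + Complex.I * t := by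
  obtain rfl | ⟨γ, a, s, hs, hsa, hγ, hP, rfl⟩ := hQ
  · exact ⟨0, le_rfl, by rw [Complex.ofReal_zero, mul_zero, add_zero]⟩
  · exact ⟨s, hs.le, hγ.energy_eq hP hs hsa⟩

theorem ascendingManifold_subset_energySurface (hP : P ∈ energySurface T) :
    ascendingManifold T P ⊆ energySurface T := by
  rintro Q (rfl | ⟨γ, a, s, hs, hsa, hγ, -, rfl⟩)
  · exact hP
  · exact (hγ s ⟨hs, hsa⟩).1

end AscendingManifold

namespace AscendingParam

variable {x : Eucl d}

theorem mem_ascendingManifold (A : AscendingParam T P) (hx : x ∈ A.domain) :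
    A.toFun x ∈ ascendingManifold T P :=
  A.image_eq ▸ mem_image_of_mem A.toFun hx

theorem apply_ne_zero (A : AscendingParam T P) (hP : P ∈ energySurface T) (hx : x ∈ A.domain)
    (i : Fin d) : (A.toFun x).1 i ≠ 0 :=
  (ascendingManifold_subset_energySurface hP (A.mem_ascendingManifold hx)).1 i

theorem continuousAt_mu (A : AscendingParam T P) (hP : P ∈ energySurface T) (hx : x ∈ A.domain) :
    ContinuousAt A.mu x := by
  have toFun_continuousAt : ContinuousAt A.toFun x :=
    A.continuousOn.continuousAt (A.isOpen_domain.mem_nhds hx)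
  refine (PiLp.continuous_toLp 2 _).continuousAt.comp (continuousAt_pi.2 fun i => ?_)
  have coordinate : ContinuousAt (fun y => (A.toFun y).1 i) x :=
    ((continuous_apply i).comp continuous_fst).continuousAt.comp toFun_continuousAt
  exact coordinate.norm.log (norm_ne_zero_iff.2 (A.apply_ne_zero hP hx i))

theorem contDiffAt_mu (A : AscendingParam T P) (hP : P ∈ energySurface T) (hx : x ∈ A.domain)
    (hx0 : x ≠ 0) : ContDiffAt ℝ ∞ A.mu x := by
  have toFun_contDiffAt : ContDiffAt ℝ ∞ A.toFun x :=
    A.smooth.contDiffAt ((A.isOpen_domain.sdiff isClosed_singleton).mem_nhds ⟨hx, hx0⟩)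
  refine contDiffAt_euclidean.2 fun i => ?_
  have coordinate : ContDiffAt ℝ ∞ (fun y => (A.toFun y).1 i) x :=
    contDiffAt_pi.1 (contDiffAt_fst.comp x toFun_contDiffAt) i
  have hne := A.apply_ne_zero hP hx i
  exact (coordinate.norm ℝ hne).log (norm_ne_zero_iff.2 hne)

theorem mem_brillouinZone_of_mu_eq_zero (A : AscendingParam T P) (hP : P ∈ energySurface T)
    (hx : x ∈ A.domain) (h : A.mu x = 0) : A.toFun x ∈ brillouinZone T :=
  ⟨ascendingManifold_subset_energySurface hP (A.mem_ascendingManifold hx), fun i =>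
    Real.eq_one_of_pos_of_log_eq_zero (norm_pos_iff.2 (A.apply_ne_zero hP hx i))
      (congrArg (fun v : Eucl d => v i) h)⟩

theorem hits_nonempty_of_hitWeight_ne_zero (A : AscendingParam T P) (h : A.hitWeight ≠ 0) :
    A.hits.Nonempty := by
  obtain ⟨x, hx, -⟩ := exists_ne_zero_of_finsum_mem_ne_zero h
  exact ⟨x, hx⟩

theorem hits_nonempty_of_windingAt_ne_zero (A : AscendingParam T P) (hP : P ∈ energySurface T)
    {t : ℝ} (ht : 0 < t) (hball : closedBall 0 t ⊆ A.domain) (h : A.windingAt t ≠ 0) :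
    A.hits.Nonempty := by
  contrapose! h
  refine windingNumber_eq_zero_of_continuousAt ht (A.continuousAt_mu hP A.zero_mem)
    (fun x hx hx0 => (A.contDiffAt_mu hP (hball hx) hx0).of_le (by exact_mod_cast le_top))
    fun x hx hμ => h.subset ⟨hball hx, A.mem_brillouinZone_of_mu_eq_zero hP (hball hx) hμ⟩

end AscendingParam

section Relevant

theorem IsRelevant.ascendingManifold_inter_brillouinZone_nonempty (h : IsRelevant T P)
    (hP : P ∈ energySurface T) : (ascendingManifold T P ∩ brillouinZone T).Nonempty := by
  obtain ⟨A, h⟩ := h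
  have hits_nonempty : A.hits.Nonempty := by
    obtain ⟨-, hw⟩ | ⟨t, ⟨ht, hball, -⟩, hw⟩ := h
    · exact A.hits_nonempty_of_hitWeight_ne_zero hw
    · exact A.hits_nonempty_of_windingAt_ne_zero hP ht hball hw
  obtain ⟨x, hx, hBZ⟩ := hits_nonempty
  exact ⟨A.toFun x, A.mem_ascendingManifold hx, hBZ⟩

theorem IsRelevant.exists_mem_pbcSpectrum (h : IsRelevant T P) (hP : P ∈ energySurface T) :
    ∃ t : ℝ, 0 ≤ t ∧ P.2 + Complex.I * t ∈ pbcSpectrum T := by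
  obtain ⟨Q, hQ, hBZ⟩ := h.ascendingManifold_inter_brillouinZone_nonempty hP
  obtain ⟨t, ht, energy_eq⟩ := exists_energy_eq_of_mem_ascendingManifold hQ
  exact ⟨t, ht, Q, hBZ, energy_eq⟩

end Relevant

section Spectrum

/-- The torus `|z_i| = 1` of Bloch phases, over which the Brillouin zone lies. -/
def unitTorus (d : ℕ) : Set (Fin d → ℂ) :=
  univ.pi fun _ => sphere 0 1

theorem mem_unitTorus {z : Fin d → ℂ} : z ∈ unitTorus d ↔ ∀ i, ‖z i‖ = 1 := by
  simp only [unitTorus, mem_univ_pi, mem_sphere_zero_iff_norm]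

theorem isCompact_unitTorus (d : ℕ) : IsCompact (unitTorus d) :=
  isCompact_univ_pi fun _ => isCompact_sphere 0 1

theorem ne_zero_of_mem_unitTorus {z : Fin d → ℂ} (hz : z ∈ unitTorus d) (i : Fin d) : z i ≠ 0 :=
  ne_zero_of_mem_unit_sphere ⟨z i, hz i (mem_univ i)⟩

theorem mem_spectrum_hamiltonian_iff (T : Hopping d N) (P : Pt d) :
    P.2 ∈ spectrum ℂ (hamiltonian T P.1) ↔ charDet T P = 0 := by
  rw [spectrum.mem_iff, Matrix.isUnit_iff_isUnit_det, isUnit_iff_ne_zero, not_not, charDet,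
    Algebra.algebraMap_eq_smul_one]

theorem mem_brillouinZone_iff :
    P ∈ brillouinZone T ↔ P.1 ∈ unitTorus d ∧ charDet T P = 0 := by
  rw [mem_unitTorus]
  exact ⟨fun h => ⟨h.2, h.1.2⟩,
    fun h => ⟨⟨ne_zero_of_mem_unitTorus (mem_unitTorus.2 h.1), h.2⟩, h.1⟩⟩

attribute [local instance] Matrix.linftyOpNormedRing Matrix.linftyOpNormedAlgebra in
theorem exists_norm_le_of_mem_brillouinZone (T : Hopping d N) :
    ∃ C : ℝ, ∀ P ∈ brillouinZone T, ‖P.2‖ ≤ C := by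
  have hamiltonian_continuousOn : ContinuousOn (hamiltonian T) (unitTorus d) := fun z hz =>
    ContinuousAt.continuousWithinAt <| continuousAt_pi.2 fun a => continuousAt_pi.2 fun b =>
      (differentiableAt_hamiltonian_apply T (ne_zero_of_mem_unitTorus hz) a b).continuousAt
  obtain ⟨C, hC⟩ := (isCompact_unitTorus d).exists_bound_of_continuousOn hamiltonian_continuousOn
  refine ⟨C * ‖(1 : Matrix (Fin N) (Fin N) ℂ)‖, fun P hP => ?_⟩
  obtain ⟨mem_torus, charDet_eq_zero⟩ := mem_brillouinZone_iff.1 hP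
  calc ‖P.2‖ ≤ ‖hamiltonian T P.1‖ * ‖(1 : Matrix (Fin N) (Fin N) ℂ)‖ :=
        spectrum.norm_le_norm_mul_of_mem ((mem_spectrum_hamiltonian_iff T P).2 charDet_eq_zero)
    _ ≤ C * ‖(1 : Matrix (Fin N) (Fin N) ℂ)‖ := by
        gcongr
        exact hC _ mem_torus

theorem isCompact_brillouinZone (T : Hopping d N) : IsCompact (brillouinZone T) := by
  obtain ⟨C, hC⟩ := exists_norm_le_of_mem_brillouinZone T
  have charDet_continuousOn : ContinuousOn (charDet T) (unitTorus d ×ˢ closedBall 0 C) :=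
    fun P hP => (differentiableAt_charDet T
      (ne_zero_of_mem_unitTorus hP.1)).continuousAt.continuousWithinAt
  have isCompact_prod : IsCompact (unitTorus d ×ˢ closedBall (0 : ℂ) C) :=
    (isCompact_unitTorus d).prod (isCompact_closedBall 0 C)
  have brillouinZone_eq :
      brillouinZone T = unitTorus d ×ˢ closedBall (0 : ℂ) C ∩ charDet T ⁻¹' {0} := by
    ext P
    refine ⟨fun hP => ?_, fun hP => mem_brillouinZone_iff.2 ⟨hP.1.1, hP.2⟩⟩
    obtain ⟨mem_torus, charDet_eq_zero⟩ := mem_brillouinZone_iff.1 hP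
    exact ⟨⟨mem_torus, mem_closedBall_zero_iff.2 (hC P hP)⟩, charDet_eq_zero⟩
  rw [brillouinZone_eq]
  exact isCompact_prod.of_isClosed_subset
    (charDet_continuousOn.preimage_isClosed_of_isClosed isCompact_prod.isClosed isClosed_singleton)
    inter_subset_left

theorem brillouinZone_nonempty (hN : 1 ≤ N) (T : Hopping d N) : (brillouinZone T).Nonempty := by
  have : Nonempty (Fin N) := ⟨⟨0, hN⟩⟩
  obtain ⟨E, hE⟩ := spectrum.nonempty_of_isAlgClosed_of_finiteDimensional ℂ
    (hamiltonian T fun _ => 1)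
  exact ⟨(fun _ => 1, E), mem_brillouinZone_iff.2 ⟨mem_unitTorus.2 fun _ => norm_one,
    (mem_spectrum_hamiltonian_iff T (fun _ => 1, E)).1 hE⟩⟩

theorem exists_isGreatest_im_pbcSpectrum (hN : 1 ≤ N) (T : Hopping d N) :
    ∃ m : ℝ, IsGreatest (Complex.im '' pbcSpectrum T) m :=
  (((isCompact_brillouinZone T).image continuous_snd).image Complex.continuous_im).exists_isGreatest
    (((brillouinZone_nonempty hN T).image _).image _)

end Spectrum

end LatticeModel

theorem mainTheorem5 {d N : ℕ} (hd : 1 ≤ d) (hN : 1 ≤ N) (T : LatticeModel.Hopping d N) :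
    (∀ P : LatticeModel.Pt d, LatticeModel.IsSaddlePoint T P → LatticeModel.IsRelevant T P →
      ∃ t : ℝ, 0 ≤ t ∧ P.2 + Complex.I * (t : ℂ) ∈ LatticeModel.pbcSpectrum T) ∧
    (∃ m : ℝ, IsGreatest (Complex.im '' LatticeModel.pbcSpectrum T) m ∧
      ∀ P : LatticeModel.Pt d, LatticeModel.IsSaddlePoint T P → LatticeModel.IsRelevant T P →
        P.2.im ≤ m) := by
  have energy_mem : ∀ P, LatticeModel.IsSaddlePoint T P → LatticeModel.IsRelevant T P →
      ∃ t : ℝ, 0 ≤ t ∧ P.2 + Complex.I * (t : ℂ) ∈ LatticeModel.pbcSpectrum T :=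
    fun P hP hrel => hrel.exists_mem_pbcSpectrum hP.1
  obtain ⟨m, hm⟩ := LatticeModel.exists_isGreatest_im_pbcSpectrum hN T
  refine ⟨energy_mem, m, hm, fun P hP hrel => ?_⟩
  obtain ⟨t, ht, hmem⟩ := energy_mem P hP hrel
  calc P.2.im ≤ P.2.im + t := le_add_of_nonneg_right ht
    _ = (P.2 + Complex.I * t).im := by rw [Complex.add_im, Complex.I_mul_im, Complex.ofReal_re]
    _ ≤ m := hm.2 ⟨_, hmem, rfl⟩
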